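/- Let $X,Y$ be random variables with finite alphabets $\mathcal X,\mathcal Y$ and joint pmf $p_{XY}$, where $p_Y(y)>0$ for every $y\in\mathcal Y$. Write $U-V-W$ if $U$ and $W$ are conditionally independent given $V$, and let $$\tilde P_W(Y\backslash X)=\max_{Q:\ X-Q-Y,\ X-Y-Q} H(Y|Q),$$ the maximum being over all finite-valued random variables $Q$ jointly distributed with $(X,Y)$. Call $y,y'\in\mathcal Y$ equivalent if $p_{X|Y}(x|y)=p_{X|Y}(x|y')$ for all $x\in\mathcal X$. Let $\mathcal Y_1,\dots,\mathcal Y_p$ be the equivalence classes and $\mathcal X_k=\{x\in\mathcal X: p_{XY}(x,y)>0\text{ for some }y\in\mathcal Y_k\}$. The pairs $(\mathcal X_k,\mathcal Y_k)$ are the components of $(\mathcal X,\mathcal Y)$; the size of $(\mathcal X_k,\mathcal Y_k)$ is $|\mathcal Y_k|$. The ergodic decomposition of $p_{XY}$ consists of the pairs $(C\cap\mathcal X,\,C\cap\mathcal Y)$, where $C$ runs through the vertex sets of the connected components of the bipartite graph on the disjoint union $\mathcal X\sqcup\mathcal Y$ in which $x$ and $y$ are joined iff $p_{XY}(x,y)>0$.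 Let $Q_*$ be the connected component containing $X$ (equivalently, almost surely, $Y$); $p_{XY}$ is called saturable if $I(X;Y|Q_*)=0$. Then the maximum defining $\tilde P_W(Y\backslash X)$ is attained, $0\le\tilde P_W(Y\backslash X)\le H(Y|X)$, and the following hold. 1. $\tilde P_W(Y\backslash X)=0$ if and only if no component has size greater than one. 2. $\tilde P_W(Y\backslash X)=H(Y|X)$ if and only if $p_{XY}$ is saturable, if and only if every component $(\mathcal X_k,\mathcal Y_k)$ is a connected component of the ergodic decomposition of $p_{XY}$. -/

import Mathlib

noncomputable section

namespace PrivateInfo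

/-! Finite probability spaces `(Ω, μ)`, `μ ∈ stdSimplex ℝ Ω`; a random variable is a function
on `Ω`. Entropies use the natural logarithm (`Real.log 0 = 0` gives `0 log 0 = 0`). -/

section InformationTheory

variable {Ω α β γ : Type*} [Fintype Ω]

open Classical in
/-- The pmf of `U`: `law μ U u = P(U = u)`. -/
def law (μ : Ω → ℝ) (U : Ω → α) (u : α) : ℝ :=
  ∑ ω with U ω = u, μ ω

/-- `H(U | V) = ∑ p(u,v) log (1 / p(u|v))`, where `1 / p(u|v) = p(v) / p(u,v)`. -/
def condEntropy [Fintype α] [Fintype β] (μ : Ω → ℝ) (U : Ω → α) (V : Ω → β) : ℝ :=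
  ∑ u, ∑ v, law μ (fun ω => (U ω, V ω)) (u, v) *
    Real.log (law μ V v / law μ (fun ω => (U ω, V ω)) (u, v))

/-- `I(U; V | W) = ∑ p(u,v,w) log (p(w) p(u,v,w) / (p(u,w) p(v,w)))`. -/
def condMutualInfo [Fintype α] [Fintype β] [Fintype γ]
    (μ : Ω → ℝ) (U : Ω → α) (V : Ω → β) (W : Ω → γ) : ℝ :=
  ∑ u, ∑ v, ∑ w, law μ (fun ω => (U ω, V ω, W ω)) (u, v, w) *
    Real.log (law μ W w * law μ (fun ω => (U ω, V ω, W ω)) (u, v, w) /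
      (law μ (fun ω => (U ω, W ω)) (u, w) * law μ (fun ω => (V ω, W ω)) (v, w)))

/-- The Markov chain `U - V - W`: `p(v) p(u,v,w) = p(u,v) p(v,w)`. -/
def Markov (μ : Ω → ℝ) (U : Ω → α) (V : Ω → β) (W : Ω → γ) : Prop :=
  ∀ u v w, law μ V v * law μ (fun ω => (U ω, V ω, W ω)) (u, v, w) =
    law μ (fun ω => (U ω, V ω)) (u, v) * law μ (fun ω => (V ω, W ω)) (v, w)

end InformationTheory

section Pair

variable {𝒳 𝒴 : Type*} [Fintype 𝒳] [Fintype 𝒴]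

/-- The values `H(Y | Q)` over all finite-valued `Q`, jointly distributed with `(X, Y) ∼ p`,
such that `X - Q - Y` and `X - Y - Q`. A point of the joint space is `((x, y), q)`. -/
def privateInfoValues (p : 𝒳 × 𝒴 → ℝ) : Set ℝ :=
  {h | ∃ n : ℕ, ∃ r ∈ stdSimplex ℝ ((𝒳 × 𝒴) × Fin n),
    law r (fun ω => ω.1) = p ∧
    Markov r (fun ω => ω.1.1) (fun ω => ω.2) (fun ω => ω.1.2) ∧
    Markov r (fun ω => ω.1.1) (fun ω => ω.1.2) (fun ω => ω.2) ∧
    h = condEntropy r (fun ω => ω.1.2) (fun ω => ω.2)}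

/-- The private information of `Y` with respect to `X`. -/
def privateInfo (p : 𝒳 × 𝒴 → ℝ) : ℝ :=
  sSup (privateInfoValues p)

/-- `p(x | y)`. -/
def condProb (p : 𝒳 × 𝒴 → ℝ) (x : 𝒳) (y : 𝒴) : ℝ :=
  p (x, y) / law p Prod.snd y

/-- `y ≡ y'` iff `p(x | y) = p(x | y')` for all `x`. -/
def condSetoid (p : 𝒳 × 𝒴 → ℝ) : Setoid 𝒴 :=
  Setoid.ker (fun y x => condProb p x y)

/-- `(A, B)` is a component of `(𝒳, 𝒴)`: `B` is an equivalence class of `≡`, and `A` consists of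
the `x` that occur together with an element of `B`. Its size is the cardinality of `B`. -/
def IsComponent (p : 𝒳 × 𝒴 → ℝ) (A : Set 𝒳) (B : Set 𝒴) : Prop :=
  B ∈ (condSetoid p).classes ∧ A = {x | ∃ y ∈ B, 0 < p (x, y)}

/-- The characteristic bipartite graph of `p`: `x` and `y` are joined iff `p(x,y) > 0`. -/
def charGraph (p : 𝒳 × 𝒴 → ℝ) : SimpleGraph (𝒳 ⊕ 𝒴) :=
  SimpleGraph.fromRel fun a b => ∃ x y, a = Sum.inl x ∧ b = Sum.inr y ∧ 0 < p (x, y)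

/-- `(A, B)` is a connected component of the ergodic decomposition of `p`. -/
def IsErgodicComponent (p : 𝒳 × 𝒴 → ℝ) (A : Set 𝒳) (B : Set 𝒴) : Prop :=
  ∃ c : (charGraph p).ConnectedComponent,
    A = {x | Sum.inl x ∈ c.supp} ∧ B = {y | Sum.inr y ∈ c.supp}

/-- The maximal common random variable: the connected component that contains `X`
(and, with probability one, `Y`). -/
def maxCommon (p : 𝒳 × 𝒴 → ℝ) (ω : 𝒳 × 𝒴) : (charGraph p).ConnectedComponent :=
  (charGraph p).connectedComponentMk (Sum.inl ω.1)

open Classical in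
/-- `p` is saturable: `I(X; Y | Q_*) = 0`, with `Q_*` the maximal common random variable. -/
def Saturable (p : 𝒳 × 𝒴 → ℝ) : Prop :=
  condMutualInfo p Prod.fst Prod.snd (maxCommon p) = 0

end Pair

end PrivateInfo

end

noncomputable section

namespace PrivateInfo

/-! ### Laws of random variables on a finite space -/

section Law

variable {Ω α β : Type*} [Fintype Ω] {μ : Ω → ℝ}

/-! Let K be the equivalence class of Y. The optimal Q is K itself, so the private information
equals H(Y|K). The chain X - Y - K is trivial, and X - K - Y holds because p(x|y) depends only on
the class of y (`condEntropy_classIndex_mem`). Conversely, if X - Q - Y and X - Y - Q, then p(x|y) =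
p(x|y,q) = p(x|q) whenever p(y,q) > 0. Hence Q determines K (`classIndex_eq_of_markov`), and Gibbs'
inequality gives H(Y|Q) ≤ H(Y|K) (`condEntropy_classIndex_upper`).

Since every y has positive mass, H(Y|K) = 0 exactly when all classes are singletons. Moreover H(Y|X)
- H(Y|K) = H(K|X), by the chain rule and X - K - Y, so the upper bound is attained exactly when X
determines K almost surely, which is `ClassDeterminedByFst`. Saturability and the description by
connected components are each shown equivalent to this condition. Under it, no edge of the graph
leaves a component, so the connected component of Y and the class of Y carry the same information.
-/

theorem law_eq_sum_ite (μ : Ω → ℝ) (U : Ω → α) (u : α) [∀ ω, Decidable (U ω = u)] :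
    law μ U u = ∑ ω, if U ω = u then μ ω else 0 := by
  rw [law, Finset.sum_filter]
  exact Finset.sum_congr rfl fun ω _ => by congr

theorem law_nonneg (hμ : ∀ ω, 0 ≤ μ ω) (U : Ω → α) (u : α) : 0 ≤ law μ U u :=
  Finset.sum_nonneg fun ω _ => hμ ω

/-- The law of `U` at `u` depends only on the event `U = u` up to null points. -/
theorem law_congr {U : Ω → α} {V : Ω → β} {u : α} {v : β}
    (h : ∀ ω, μ ω ≠ 0 → (U ω = u ↔ V ω = v)) : law μ U u = law μ V v := by
  classical
  rw [law_eq_sum_ite, law_eq_sum_ite]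
  refine Finset.sum_congr rfl fun ω _ => ?_
  by_cases h0 : μ ω = 0
  · simp [h0]
  · simp [h ω h0]

theorem law_eq_zero {U : Ω → α} {u : α} (h : ∀ ω, μ ω ≠ 0 → U ω ≠ u) : law μ U u = 0 := by
  classical
  rw [law_eq_sum_ite]
  refine Finset.sum_eq_zero fun ω _ => ?_
  by_cases h0 : μ ω = 0
  · simp [h0]
  · simp [h ω h0]

theorem law_mono (hμ : ∀ ω, 0 ≤ μ ω) {U : Ω → α} {V : Ω → β} {u : α} {v : β}
    (h : ∀ ω, U ω = u → V ω = v) : law μ U u ≤ law μ V v := by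
  classical
  rw [law, law]
  refine Finset.sum_le_sum_of_subset_of_nonneg ?_ fun ω _ _ => hμ ω
  intro ω
  simpa using h ω

theorem eq_of_law_eq (hμ : ∀ ω, 0 ≤ μ ω) {U : Ω → α} {V : Ω → β} {u : α} {v : β}
    (h : ∀ ω, U ω = u → V ω = v) (heq : law μ U u = law μ V v) {ω : Ω} (hω : 0 < μ ω)
    (hV : V ω = v) : U ω = u := by
  classical
  by_contra hU
  rw [law_eq_sum_ite, law_eq_sum_ite] at heq
  refine absurd heq (ne_of_lt (Finset.sum_lt_sum (fun i _ => ?_) ⟨ω, Finset.mem_univ _, ?_⟩))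
  · by_cases hi : U i = u
    · simp [hi, h i hi]
    · rw [if_neg hi]
      split_ifs
      exacts [hμ i, le_rfl]
  · simpa [hU, hV] using hω

theorem law_of_injective {U : Ω → α} (hU : Function.Injective U) (ω : Ω) :
    law μ U (U ω) = μ ω := by
  classical
  simp [law_eq_sum_ite, hU.eq_iff]

theorem le_law (hμ : ∀ ω, 0 ≤ μ ω) (U : Ω → α) (ω : Ω) : μ ω ≤ law μ U (U ω) := by
  rw [← law_of_injective (μ := μ) Function.injective_id ω]
  exact law_mono hμ fun ω' h => by rw [show ω' = ω from h]

theorem exists_pos_of_law_pos (hμ : ∀ ω, 0 ≤ μ ω) {U : Ω → α} {u : α} (h : 0 < law μ U u) :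
    ∃ ω, U ω = u ∧ 0 < μ ω := by
  by_contra! hc
  exact h.ne' (law_eq_zero fun ω h0 hω => h0 (le_antisymm (hc ω hω) (hμ ω)))

/-- Expectations of functions of `U` may be computed from the law of `U`. -/
theorem sum_law_mul [Fintype α] (μ : Ω → ℝ) (U : Ω → α) (g : α → ℝ) :
    ∑ u, law μ U u * g u = ∑ ω, μ ω * g (U ω) := by
  classical
  simp_rw [law_eq_sum_ite, Finset.sum_mul]
  rw [Finset.sum_comm]
  simp [ite_mul]

theorem sum_law [Fintype α] (μ : Ω → ℝ) (U : Ω → α) : ∑ u, law μ U u = ∑ ω, μ ω := by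
  simpa using sum_law_mul μ U fun _ => 1

theorem law_law [Fintype α] (μ : Ω → ℝ) (U : Ω → α) (f : α → β) :
    law (law μ U) f = law μ fun ω => f (U ω) := by
  classical
  funext b
  have h := sum_law_mul μ U fun a => if f a = b then 1 else 0
  simpa [law_eq_sum_ite (law μ U), law_eq_sum_ite μ fun ω => f (U ω)] using h

theorem sum_law_fst [Fintype α] (μ : Ω → ℝ) (U : Ω → α) (V : Ω → β) (v : β) :
    ∑ u, law μ (fun ω => (U ω, V ω)) (u, v) = law μ V v := by
  classical
  simp_rw [law_eq_sum_ite, Prod.mk.injEq]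
  rw [Finset.sum_comm]
  simp [ite_and]

theorem condEntropy_eq_sum [Fintype α] [Fintype β] (μ : Ω → ℝ) (U : Ω → α) (V : Ω → β) :
    condEntropy μ U V =
      ∑ ω, μ ω * Real.log (law μ V (V ω) / law μ (fun ω => (U ω, V ω)) (U ω, V ω)) := by
  rw [condEntropy, ← Fintype.sum_prod_type']
  exact sum_law_mul μ (fun ω => (U ω, V ω))
    fun a => Real.log (law μ V a.2 / law μ (fun ω => (U ω, V ω)) a)

end Law

/-! ### Gibbs' inequality and its equality case -/

section Gibbs

/-- Adding the correction -a + b makes each term of a divergence nonnegative, vanishing only at a =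
b. The hypothesis is absolute continuity, needed because a / 0 = 0. -/
theorem mul_log_div_sub_add {a b : ℝ} (h : b = 0 → a = 0) :
    a * Real.log (a / b) - a + b = b * InformationTheory.klFun (a / b) := by
  rcases eq_or_ne b 0 with rfl | hb
  · simp [h rfl]
  · rw [InformationTheory.klFun]
    field_simp
    ring

variable {ι : Type*} [Fintype ι] {a b : ι → ℝ}

/-- Gibbs' inequality. -/
theorem sum_mul_log_div_nonneg (ha : ∀ i, 0 ≤ a i) (hb : ∀ i, 0 ≤ b i)
    (hab : ∀ i, b i = 0 → a i = 0) (hsum : ∑ i, b i ≤ ∑ i, a i) :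
    0 ≤ ∑ i, a i * Real.log (a i / b i) := by
  have h : 0 ≤ ∑ i, (a i * Real.log (a i / b i) - a i + b i) :=
    Finset.sum_nonneg fun i _ => by
      rw [mul_log_div_sub_add (hab i)]
      exact mul_nonneg (hb i) (InformationTheory.klFun_nonneg (div_nonneg (ha i) (hb i)))
  rw [Finset.sum_add_distrib, Finset.sum_sub_distrib] at h
  linarith

/-- The equality case of Gibbs' inequality. -/
theorem eq_of_sum_mul_log_div_eq_zero (ha : ∀ i, 0 ≤ a i) (hb : ∀ i, 0 ≤ b i)
    (hab : ∀ i, b i = 0 → a i = 0) (hsum : ∑ i, b i ≤ ∑ i, a i)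
    (h0 : ∑ i, a i * Real.log (a i / b i) = 0) (i : ι) : a i = b i := by
  have hnn : ∀ i ∈ Finset.univ, 0 ≤ a i * Real.log (a i / b i) - a i + b i := fun i _ => by
    rw [mul_log_div_sub_add (hab i)]
    exact mul_nonneg (hb i) (InformationTheory.klFun_nonneg (div_nonneg (ha i) (hb i)))
  have h : ∑ i, (a i * Real.log (a i / b i) - a i + b i) = 0 := by
    refine le_antisymm ?_ (Finset.sum_nonneg hnn)
    rw [Finset.sum_add_distrib, Finset.sum_sub_distrib]
    linarith
  have hi := (Finset.sum_eq_zero_iff_of_nonneg hnn).1 h i (Finset.mem_univ i)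
  rw [mul_log_div_sub_add (hab i), mul_eq_zero] at hi
  rcases hi with hi | hi
  · rw [hi, hab i hi]
  · rw [InformationTheory.klFun_eq_zero_iff (div_nonneg (ha i) (hb i))] at hi
    exact eq_of_div_eq_one hi

end Gibbs

/-! ### Conditional mutual information as a divergence -/

section MutualInfo

variable {Ω α β γ : Type*} [Fintype Ω] [Fintype α] [Fintype β] [Fintype γ] {μ : Ω → ℝ}

/-- Conditional mutual information vanishes exactly under conditional independence. -/
theorem condMutualInfo_eq_zero_iff (hμ : ∀ ω, 0 ≤ μ ω) (U : Ω → α) (V : Ω → β) (W : Ω → γ) :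
    condMutualInfo μ U V W = 0 ↔
      ∀ u v w, law μ W w * law μ (fun ω => (U ω, V ω, W ω)) (u, v, w) =
        law μ (fun ω => (U ω, W ω)) (u, w) * law μ (fun ω => (V ω, W ω)) (v, w) := by
  set a : α × β × γ → ℝ := law μ fun ω => (U ω, V ω, W ω) with ha
  -- The conditionally independent law p(w) p(u|w) p(v|w); the mutual information is the divergence
  -- of `a` from it.
  set b : α × β × γ → ℝ := fun i =>
    law μ (fun ω => (U ω, W ω)) (i.1, i.2.2) * law μ (fun ω => (V ω, W ω)) (i.2.1, i.2.2) /
      law μ W i.2.2 with hb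
  have hUW : ∀ u w, law μ (fun ω => (U ω, W ω)) (u, w) ≤ law μ W w := fun u w =>
    law_mono hμ fun ω h => (Prod.mk.inj h).2
  have haU : ∀ u v w, a (u, v, w) ≤ law μ (fun ω => (U ω, W ω)) (u, w) := fun u v w =>
    law_mono hμ fun ω h => by simp_all
  have haV : ∀ u v w, a (u, v, w) ≤ law μ (fun ω => (V ω, W ω)) (v, w) := fun u v w =>
    law_mono hμ fun ω h => by simp_all
  have ha0 : ∀ i, 0 ≤ a i := law_nonneg hμ _
  have hb0 : ∀ i, 0 ≤ b i := fun i =>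
    div_nonneg (mul_nonneg (law_nonneg hμ _ _) (law_nonneg hμ _ _)) (law_nonneg hμ _ _)
  have hab : ∀ i, b i = 0 → a i = 0 := by
    rintro ⟨u, v, w⟩ h
    refine le_antisymm ?_ (ha0 _)
    rcases div_eq_zero_iff.1 h with h | h
    · rcases mul_eq_zero.1 h with h | h
      · exact (haU u v w).trans_eq h
      · exact (haV u v w).trans_eq h
    · exact ((haU u v w).trans (hUW u w)).trans_eq h
  have hsum : ∑ i, b i = ∑ i, a i := by
    rw [sum_law, ← sum_law μ W, Fintype.sum_prod_type]
    simp_rw [Fintype.sum_prod_type]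
    simp_rw [hb]
    rw [Finset.sum_congr rfl fun u _ => Finset.sum_comm, Finset.sum_comm]
    refine Finset.sum_congr rfl fun w _ => ?_
    simp_rw [← Finset.sum_div, ← Finset.mul_sum, ← Finset.sum_mul, sum_law_fst]
    exact mul_self_div_self _
  have hI : condMutualInfo μ U V W = ∑ i, a i * Real.log (a i / b i) := by
    rw [condMutualInfo, Fintype.sum_prod_type]
    simp_rw [Fintype.sum_prod_type]
    refine Finset.sum_congr rfl fun u _ => Finset.sum_congr rfl fun v _ =>
      Finset.sum_congr rfl fun w _ => ?_
    simp only [ha, hb]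
    rw [div_div_eq_mul_div, mul_comm (law μ W w)]
  rw [hI]
  constructor
  · intro h u v w
    have h' : a (u, v, w) = b (u, v, w) :=
      eq_of_sum_mul_log_div_eq_zero ha0 hb0 hab hsum.le h _
    rcases eq_or_ne (law μ W w) 0 with hw | hw
    · have hu : law μ (fun ω => (U ω, W ω)) (u, w) = 0 :=
        le_antisymm ((hUW u w).trans_eq hw) (law_nonneg hμ _ _)
      rw [hw, hu, zero_mul, zero_mul]
    · rw [h', hb]
      exact mul_div_cancel₀ _ hw
  · refine fun h => Finset.sum_eq_zero fun ⟨u, v, w⟩ _ => ?_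
    rcases eq_or_ne (a (u, v, w)) 0 with h0 | h0
    · rw [h0, zero_mul]
    · have hw : law μ W w ≠ 0 := fun hw =>
        h0 (le_antisymm (((haU u v w).trans (hUW u w)).trans_eq hw) (ha0 _))
      have : b (u, v, w) = a (u, v, w) := by
        rw [hb]
        simp only
        rw [← h u v w, mul_div_cancel_left₀ _ hw]
      rw [this, div_self h0, Real.log_one, mul_zero]

end MutualInfo

/-! ### The class of Y, the maximum, and both extreme cases -/

section Classes

variable {𝒳 𝒴 : Type*} [Fintype 𝒳] [Fintype 𝒴] {p : 𝒳 × 𝒴 → ℝ}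

open Classical in
/-- The equivalence class of `y`, as an element of an initial segment of `ℕ`. -/
def classIndex (p : 𝒳 × 𝒴 → ℝ) (y : 𝒴) : Fin (Fintype.card (Quotient (condSetoid p))) :=
  Fintype.equivFin (Quotient (condSetoid p)) (Quotient.mk (condSetoid p) y)

theorem classIndex_eq_iff {y y' : 𝒴} :
    classIndex p y = classIndex p y' ↔ ∀ x, condProb p x y = condProb p x y' := by
  rw [classIndex, classIndex, Equiv.apply_eq_iff_eq, Quotient.eq]
  exact funext_iff

theorem eq_condProb_mul (hY : ∀ y, 0 < law p Prod.snd y) (x : 𝒳) (y : 𝒴) :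
    p (x, y) = condProb p x y * law p Prod.snd y :=
  (div_mul_cancel₀ _ (hY y).ne').symm

/-- Equivalent symbols `y`, `y'` occur with the same `x`. -/
theorem pos_of_classIndex_eq (hY : ∀ y, 0 < law p Prod.snd y) {x : 𝒳} {y y' : 𝒴}
    (h : classIndex p y = classIndex p y') (hxy : 0 < p (x, y)) : 0 < p (x, y') := by
  rw [eq_condProb_mul hY, ← classIndex_eq_iff.1 h x]
  exact mul_pos (div_pos hxy (hY y)) (hY y')

/-- `P(X = x, Y ≡ y) = p(x | y) P(Y ≡ y)`. -/
theorem law_fst_classIndex (hY : ∀ y, 0 < law p Prod.snd y) (x : 𝒳) (y : 𝒴) :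
    law p (fun ω => (ω.1, classIndex p ω.2)) (x, classIndex p y) =
      condProb p x y * law p (fun ω => classIndex p ω.2) (classIndex p y) := by
  classical
  rw [← law_law p Prod.snd, law_eq_sum_ite, law_eq_sum_ite, Fintype.sum_prod_type,
    Finset.sum_comm, Finset.mul_sum]
  refine Finset.sum_congr rfl fun y' _ => ?_
  by_cases h : classIndex p y' = classIndex p y
  · rw [if_pos h, ← classIndex_eq_iff.1 h x, ← eq_condProb_mul hY]
    simp [h]
  · simp [h]

/-- This is the chain X - K - Y at k = K(y); at every other k both sides vanish. -/
theorem law_class_mul (hY : ∀ y, 0 < law p Prod.snd y) (x : 𝒳) (y : 𝒴) :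
    law p (fun ω => classIndex p ω.2) (classIndex p y) * p (x, y) =
      law p (fun ω => (ω.1, classIndex p ω.2)) (x, classIndex p y) * law p Prod.snd y := by
  rw [law_fst_classIndex hY, eq_condProb_mul hY x y]
  ring

theorem law_snd_le_law_class (hp : ∀ ω, 0 ≤ p ω) (y : 𝒴) :
    law p Prod.snd y ≤ law p (fun ω => classIndex p ω.2) (classIndex p y) :=
  law_mono hp fun ω h => by rw [h]

theorem condEntropy_classIndex (p : 𝒳 × 𝒴 → ℝ) :
    condEntropy p Prod.snd (fun ω => classIndex p ω.2) =
      ∑ ω, p ω * Real.log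
        (law p (fun ω => classIndex p ω.2) (classIndex p ω.2) / law p Prod.snd ω.2) := by
  rw [condEntropy_eq_sum]
  refine Finset.sum_congr rfl fun ω _ => ?_
  rw [law_congr (U := fun ω : 𝒳 × 𝒴 => (ω.2, classIndex p ω.2)) (V := Prod.snd) (v := ω.2)]
  intro ω' _
  simp only [Prod.mk.injEq, and_iff_left_iff_imp]
  exact fun h => by rw [h]

theorem condEntropy_classIndex_mem (hp : p ∈ stdSimplex ℝ (𝒳 × 𝒴))
    (hY : ∀ y, 0 < law p Prod.snd y) :
    condEntropy p Prod.snd (fun ω => classIndex p ω.2) ∈ privateInfoValues p := by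
  refine ⟨_, law p fun ω => (ω, classIndex p ω.2), ⟨law_nonneg hp.1 _, ?_⟩, ?_, ?_, ?_, ?_⟩
  · rw [sum_law, hp.2]
  · rw [law_law]
    exact funext fun ω => law_of_injective Function.injective_id ω
  · intro x k y
    simp only [law_law]
    by_cases hk : k = classIndex p y
    · subst hk
      rw [law_congr (U := fun ω : 𝒳 × 𝒴 => (ω.1, classIndex p ω.2, ω.2)) (V := id)
        (v := (x, y)), law_congr (U := fun ω : 𝒳 × 𝒴 => (classIndex p ω.2, ω.2))
        (V := Prod.snd) (v := y), show (x, y) = id (x, y) from rfl,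
        law_of_injective Function.injective_id]
      · exact law_class_mul hY x y
      · intro ω _
        simp only [Prod.mk.injEq, and_iff_right_iff_imp]
        exact fun h => by rw [h]
      · rintro ⟨x', y'⟩ _
        simp only [Prod.mk.injEq, id]
        constructor
        · exact fun h => ⟨h.1, h.2.2⟩
        · rintro ⟨rfl, rfl⟩
          exact ⟨rfl, rfl, rfl⟩
    · rw [law_eq_zero (U := fun ω : 𝒳 × 𝒴 => (ω.1, classIndex p ω.2, ω.2)), mul_zero,
        law_eq_zero (U := fun ω : 𝒳 × 𝒴 => (classIndex p ω.2, ω.2)), mul_zero]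
      · rintro ω _ h
        simp only [Prod.mk.injEq] at h
        exact hk (by rw [← h.1, h.2])
      · rintro ω _ h
        simp only [Prod.mk.injEq] at h
        exact hk (by rw [← h.2.1, h.2.2])
  · intro x y k
    simp only [law_law]
    by_cases hk : k = classIndex p y
    · subst hk
      rw [mul_comm]
      congr 1
      · refine law_congr fun ω _ => ?_
        simp only [Prod.mk.injEq]
        exact ⟨fun h => ⟨h.1, h.2.1⟩, fun h => ⟨h.1, h.2, by rw [h.2]⟩⟩
      · refine law_congr fun ω _ => ?_
        simp only [Prod.mk.injEq]
        exact ⟨fun h => ⟨h, by rw [h]⟩, fun h => h.1⟩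
    · rw [law_eq_zero (U := fun ω : 𝒳 × 𝒴 => (ω.1, ω.2, classIndex p ω.2)), mul_zero,
        law_eq_zero (U := fun ω : 𝒳 × 𝒴 => (ω.2, classIndex p ω.2)), mul_zero]
      · rintro ω _ h
        simp only [Prod.mk.injEq] at h
        exact hk (by rw [← h.2, h.1])
      · rintro ω _ h
        simp only [Prod.mk.injEq] at h
        exact hk (by rw [← h.2.2, h.2.1])
  · simp only [condEntropy, law_law]

/-- If `X - Q - Y` and `X - Y - Q`, then the class of `Y` is a function of `Q`. -/
theorem classIndex_eq_of_markov {n : ℕ} {r : (𝒳 × 𝒴) × Fin n → ℝ} (hr : ∀ ω, 0 ≤ r ω)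
    (hrp : law r (fun ω => ω.1) = p) (hY : ∀ y, 0 < law p Prod.snd y)
    (h₁ : Markov r (fun ω => ω.1.1) (fun ω => ω.2) (fun ω => ω.1.2))
    (h₂ : Markov r (fun ω => ω.1.1) (fun ω => ω.1.2) (fun ω => ω.2)) {q : Fin n} {y y' : 𝒴}
    (hy : 0 < law r (fun ω => (ω.1.2, ω.2)) (y, q))
    (hy' : 0 < law r (fun ω => (ω.1.2, ω.2)) (y', q)) : classIndex p y = classIndex p y' := by
  rw [classIndex_eq_iff]
  -- The right side does not mention z, so all symbols compatible with q have the same conditional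
  -- law of X.
  suffices H : ∀ x z, 0 < law r (fun ω => (ω.1.2, ω.2)) (z, q) →
      condProb p x z = law r (fun ω => (ω.1.1, ω.2)) (x, q) / law r (fun ω => ω.2) q by
    intro x
    rw [H x y hy, H x y' hy']
  intro x z hz
  have hq : 0 < law r (fun ω => ω.2) q :=
    hz.trans_le (law_mono hr fun ω h => (Prod.mk.inj h).2)
  have e₁ := h₁ x q z
  have e₂ := h₂ x z q
  rw [show law r (fun ω => ω.1.2) z = law p Prod.snd z by rw [← hrp, law_law],
    show law r (fun ω => (ω.1.1, ω.1.2)) (x, z) = p (x, z) by rw [← hrp]] at e₂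
  rw [law_congr (U := fun ω : (𝒳 × 𝒴) × Fin n => (ω.1.1, ω.2, ω.1.2))
      (V := fun ω : (𝒳 × 𝒴) × Fin n => (ω.1.1, ω.1.2, ω.2)) (v := (x, z, q))
      fun ω _ => by simp only [Prod.mk.injEq]; tauto,
    law_congr (U := fun ω : (𝒳 × 𝒴) × Fin n => (ω.2, ω.1.2))
      (V := fun ω : (𝒳 × 𝒴) × Fin n => (ω.1.2, ω.2)) (v := (z, q))
      fun ω _ => by simp only [Prod.mk.injEq]; tauto] at e₁
  rw [condProb, div_eq_div_iff (hY z).ne' hq.ne']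
  -- After multiplying by p(z,q), both chains evaluate p(x,z,q), which can then be eliminated.
  refine mul_right_cancel₀ hz.ne' ?_
  linear_combination law p Prod.snd z * e₁ - law r (fun ω => ω.2) q * e₂

/-- H(Y|K) - H(Y|Q) is the divergence of the law of (Y,Q) from the weights p(q) p(y|K(y)), cut down
to the support of that law. -/
theorem condEntropy_classIndex_upper (hp : ∀ ω, 0 ≤ p ω) (hY : ∀ y, 0 < law p Prod.snd y) {h : ℝ}
    (hh : h ∈ privateInfoValues p) : h ≤ condEntropy p Prod.snd (fun ω => classIndex p ω.2) := by
  classical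
  obtain ⟨n, r, ⟨hr, -⟩, hrp, h₁, h₂, rfl⟩ := hh
  set a : 𝒴 × Fin n → ℝ := law r fun ω => (ω.1.2, ω.2) with ha
  set s : 𝒴 → ℝ := fun y => law p (fun ω => classIndex p ω.2) (classIndex p y) with hs
  have hs0 : ∀ y, 0 < s y := fun y => (hY y).trans_le (law_snd_le_law_class hp y)
  -- Without the restriction to the support, every class would contribute for each q. With it, only
  -- one class does, so the weights over a fixed q sum to at most p(q).
  set b : 𝒴 × Fin n → ℝ := fun i =>
    if 0 < a i then law r (fun ω => ω.2) i.2 * (law p Prod.snd i.1 / s i.1) else 0 with hb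
  have ha0 : ∀ i, 0 ≤ a i := law_nonneg hr _
  have hq : ∀ i, 0 < a i → 0 < law r (fun ω => ω.2) i.2 := fun i hi =>
    hi.trans_le (law_mono hr fun ω h => by rw [← h])
  have hb0 : ∀ i, 0 ≤ b i := fun i => by
    simp only [hb]
    split_ifs with hi
    · exact (mul_pos (hq i hi) (div_pos (hY _) (hs0 _))).le
    · exact le_rfl
  have hab : ∀ i, b i = 0 → a i = 0 := fun i hi => by
    by_contra hne
    have hpos := lt_of_le_of_ne (ha0 i) (Ne.symm hne)
    simp only [hb, if_pos hpos] at hi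
    exact (mul_pos (hq i hpos) (div_pos (hY _) (hs0 _))).ne' hi
  have hsum : ∑ i, b i ≤ ∑ i, a i := by
    rw [sum_law, ← sum_law r fun ω => ω.2, Fintype.sum_prod_type, Finset.sum_comm]
    refine Finset.sum_le_sum fun q _ => ?_
    by_cases hex : ∃ y₀, 0 < a (y₀, q)
    · obtain ⟨y₀, hy₀⟩ := hex
      have hle : ∀ y, b (y, q) ≤ law r (fun ω => ω.2) q / s y₀ *
          if classIndex p y = classIndex p y₀ then law p Prod.snd y else 0 := by
        intro y
        simp only [hb]
        split_ifs with hy hc hc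
        · rw [show s y = s y₀ by simp only [hs, hc]]
          exact le_of_eq (by ring)
        · exact absurd (classIndex_eq_of_markov hr hrp hY h₁ h₂ hy hy₀) hc
        · exact mul_nonneg (div_nonneg (law_nonneg hr _ _) (hs0 _).le) (hY _).le
        · simp
      refine (Finset.sum_le_sum fun y _ => hle y).trans_eq ?_
      rw [← Finset.mul_sum, ← law_eq_sum_ite (law p Prod.snd) (classIndex p), law_law]
      exact div_mul_cancel₀ _ (hs0 y₀).ne'
    · push Not at hex
      rw [Finset.sum_eq_zero fun y _ => by simp only [hb, if_neg (hex y).not_gt]]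
      exact law_nonneg hr _ _
  have hM : condEntropy p Prod.snd (fun ω => classIndex p ω.2) =
      ∑ i, a i * Real.log (s i.1 / law p Prod.snd i.1) := by
    rw [condEntropy_classIndex, ha,
      sum_law_mul r (fun ω => (ω.1.2, ω.2)) fun i => Real.log (s i.1 / law p Prod.snd i.1)]
    have := sum_law_mul r (fun ω => ω.1) fun ω => Real.log (s ω.2 / law p Prod.snd ω.2)
    rw [hrp] at this
    exact this
  have hH : condEntropy r (fun ω => ω.1.2) (fun ω => ω.2) =
      ∑ i, a i * Real.log (law r (fun ω => ω.2) i.2 / a i) := by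
    rw [condEntropy, Fintype.sum_prod_type]
  have hG := sum_mul_log_div_nonneg ha0 hb0 hab hsum
  rw [hM, hH, ← sub_nonneg, ← Finset.sum_sub_distrib]
  refine hG.trans_eq (Finset.sum_congr rfl fun i _ => ?_)
  rcases (ha0 i).eq_or_lt with h0 | h0
  · simp [← h0]
  · have hq' := hq i h0
    rw [← mul_sub, ← Real.log_div (div_pos (hs0 _) (hY _)).ne' (div_pos hq' h0).ne']
    simp only [hb, if_pos h0]
    have := (hs0 i.1).ne'
    have := (hY i.1).ne'
    congr 2
    field_simp

theorem isGreatest_condEntropy_classIndex (hp : p ∈ stdSimplex ℝ (𝒳 × 𝒴))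
    (hY : ∀ y, 0 < law p Prod.snd y) :
    IsGreatest (privateInfoValues p) (condEntropy p Prod.snd fun ω => classIndex p ω.2) :=
  ⟨condEntropy_classIndex_mem hp hY, fun _ h => condEntropy_classIndex_upper hp.1 hY h⟩

theorem privateInfo_eq (hp : p ∈ stdSimplex ℝ (𝒳 × 𝒴)) (hY : ∀ y, 0 < law p Prod.snd y) :
    privateInfo p = condEntropy p Prod.snd fun ω => classIndex p ω.2 :=
  (isGreatest_condEntropy_classIndex hp hY).csSup_eq

theorem mul_log_law_class_nonneg (hp : ∀ ω, 0 ≤ p ω) (hY : ∀ y, 0 < law p Prod.snd y)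
    (ω : 𝒳 × 𝒴) : 0 ≤ p ω * Real.log
      (law p (fun ω => classIndex p ω.2) (classIndex p ω.2) / law p Prod.snd ω.2) :=
  mul_nonneg (hp ω)
    (Real.log_nonneg ((one_le_div (hY _)).2 (law_snd_le_law_class hp _)))

theorem condEntropy_classIndex_nonneg (hp : ∀ ω, 0 ≤ p ω) (hY : ∀ y, 0 < law p Prod.snd y) :
    0 ≤ condEntropy p Prod.snd fun ω => classIndex p ω.2 := by
  rw [condEntropy_classIndex]
  exact Finset.sum_nonneg fun ω _ => mul_log_law_class_nonneg hp hY ω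

theorem condEntropy_classIndex_eq_zero_iff (hp : ∀ ω, 0 ≤ p ω)
    (hY : ∀ y, 0 < law p Prod.snd y) :
    (condEntropy p Prod.snd fun ω => classIndex p ω.2) = 0 ↔
      Function.Injective (classIndex p) := by
  rw [condEntropy_classIndex,
    Finset.sum_eq_zero_iff_of_nonneg fun ω _ => mul_log_law_class_nonneg hp hY ω]
  constructor
  · intro h y' y hyy
    obtain ⟨ω, rfl, hω⟩ := exists_pos_of_law_pos hp (hY y)
    obtain ⟨ω', rfl, hω'⟩ := exists_pos_of_law_pos hp (hY y')
    have h' := (mul_eq_zero.1 (h _ (Finset.mem_univ _))).resolve_left hω.ne'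
    have hle := law_snd_le_law_class hp ω.2
    have heq := Real.eq_one_of_pos_of_log_eq_zero
      (div_pos ((hY _).trans_le hle) (hY _)) h'
    -- The events Y = y and K = K(y) have equal mass, so no point of positive mass separates them.
    exact eq_of_law_eq hp (fun ω h => by rw [h]) (eq_of_div_eq_one heq).symm hω' hyy
  · intro h ω _
    rw [law_congr (V := Prod.snd) (v := ω.2) fun ω' _ => h.eq_iff, div_self (hY _).ne',
      Real.log_one, mul_zero]

theorem component_size_le_one_iff :
    (¬ ∃ (A : Set 𝒳) (B : Set 𝒴), IsComponent p A B ∧ 1 < B.ncard) ↔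
      Function.Injective (classIndex p) := by
  have hiff : ∀ y y', classIndex p y = classIndex p y' ↔ condSetoid p y y' := fun y y' =>
    classIndex_eq_iff.trans funext_iff.symm
  constructor
  · intro h y y' hyy
    by_contra hne
    refine h ⟨_, {z | condSetoid p z y}, ⟨(condSetoid p).mem_classes y, rfl⟩, ?_⟩
    rw [Set.one_lt_ncard]
    exact ⟨y, (hiff _ _).1 rfl, y', (hiff _ _).1 hyy.symm, hne⟩
  · rintro h ⟨A, _, ⟨⟨y, rfl⟩, -⟩, hB⟩
    obtain ⟨z, hz, z', hz', hne⟩ := (Set.one_lt_ncard).1 hB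
    exact hne (h (((hiff _ _).2 hz).trans ((hiff _ _).2 hz').symm))

/-- The class of `Y` is almost surely a function of `X`. -/
def ClassDeterminedByFst (p : 𝒳 × 𝒴 → ℝ) : Prop :=
  ∀ x y y', 0 < p (x, y) → 0 < p (x, y') → classIndex p y = classIndex p y'

/-- P(X = x, K = k) = P(X = x) says that K = k almost surely on X = x. -/
theorem law_fst_classIndex_eq_iff (hp : ∀ ω, 0 ≤ p ω) :
    (∀ x y, 0 < p (x, y) →
      law p (fun ω => (ω.1, classIndex p ω.2)) (x, classIndex p y) = law p Prod.fst x) ↔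
      ClassDeterminedByFst p := by
  constructor
  · intro h x y y' hy hy'
    have := eq_of_law_eq hp (fun ω hω => (Prod.mk.inj hω).1) (h x y hy) (ω := (x, y')) hy' rfl
    exact (Prod.mk.inj this).2.symm
  · intro h x y hy
    refine law_congr fun ω hω => ?_
    simp only [Prod.mk.injEq, and_iff_left_iff_imp]
    rintro rfl
    exact h _ _ _ (lt_of_le_of_ne (hp ω) hω.symm) hy

theorem condEntropy_snd_fst (p : 𝒳 × 𝒴 → ℝ) :
    condEntropy p Prod.snd Prod.fst = ∑ ω, p ω * Real.log (law p Prod.fst ω.1 / p ω) := by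
  rw [condEntropy_eq_sum]
  refine Finset.sum_congr rfl fun ω _ => ?_
  rw [law_of_injective (U := fun ω : 𝒳 × 𝒴 => (ω.2, ω.1)) Prod.swap_injective]

/-- Pointwise form of H(Y|X) - H(Y|K) = H(K|X), resting on p(k) p(x,y) = p(x,k) p(y). -/
theorem mul_log_law_fst_sub (hp : ∀ ω, 0 ≤ p ω) (hY : ∀ y, 0 < law p Prod.snd y)
    (ω : 𝒳 × 𝒴) :
    p ω * Real.log (law p Prod.fst ω.1 / p ω) - p ω * Real.log
      (law p (fun ω => classIndex p ω.2) (classIndex p ω.2) / law p Prod.snd ω.2) =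
    p ω * Real.log (law p Prod.fst ω.1 /
      law p (fun ω => (ω.1, classIndex p ω.2)) (ω.1, classIndex p ω.2)) := by
  rcases (hp ω).eq_or_lt with h0 | h0
  · simp [← h0]
  have hX := h0.trans_le (le_law hp Prod.fst ω)
  have hJ := h0.trans_le (le_law hp (fun ω => (ω.1, classIndex p ω.2)) ω)
  have hs := (hY ω.2).trans_le (law_snd_le_law_class hp ω.2)
  have key := law_class_mul hY ω.1 ω.2
  rw [← mul_sub, ← Real.log_div (div_pos hX h0).ne' (div_pos hs (hY _)).ne']
  congr 2
  rw [div_div_div_eq, div_eq_div_iff (mul_pos h0 hs).ne' hJ.ne']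
  linear_combination -law p Prod.fst ω.1 * key

theorem mul_log_law_fst_nonneg (hp : ∀ ω, 0 ≤ p ω) (ω : 𝒳 × 𝒴) :
    0 ≤ p ω * Real.log (law p Prod.fst ω.1 /
      law p (fun ω => (ω.1, classIndex p ω.2)) (ω.1, classIndex p ω.2)) := by
  rcases (hp ω).eq_or_lt with h0 | h0
  · simp [← h0]
  have hJ := h0.trans_le (le_law hp (fun ω => (ω.1, classIndex p ω.2)) ω)
  exact mul_nonneg h0.le (Real.log_nonneg
    ((one_le_div hJ).2 (law_mono hp fun ω h => (Prod.mk.inj h).1)))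

theorem condEntropy_sub_condEntropy_classIndex (hp : ∀ ω, 0 ≤ p ω)
    (hY : ∀ y, 0 < law p Prod.snd y) :
    condEntropy p Prod.snd Prod.fst - (condEntropy p Prod.snd fun ω => classIndex p ω.2) =
      ∑ ω, p ω * Real.log (law p Prod.fst ω.1 /
        law p (fun ω => (ω.1, classIndex p ω.2)) (ω.1, classIndex p ω.2)) := by
  rw [condEntropy_snd_fst, condEntropy_classIndex, ← Finset.sum_sub_distrib]
  exact Finset.sum_congr rfl fun ω _ => mul_log_law_fst_sub hp hY ω

theorem condEntropy_classIndex_le (hp : ∀ ω, 0 ≤ p ω) (hY : ∀ y, 0 < law p Prod.snd y) :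
    (condEntropy p Prod.snd fun ω => classIndex p ω.2) ≤ condEntropy p Prod.snd Prod.fst := by
  rw [← sub_nonneg, condEntropy_sub_condEntropy_classIndex hp hY]
  exact Finset.sum_nonneg fun ω _ => mul_log_law_fst_nonneg hp ω

theorem condEntropy_classIndex_eq_iff (hp : ∀ ω, 0 ≤ p ω) (hY : ∀ y, 0 < law p Prod.snd y) :
    (condEntropy p Prod.snd fun ω => classIndex p ω.2) = condEntropy p Prod.snd Prod.fst ↔
      ClassDeterminedByFst p := by
  rw [eq_comm, ← sub_eq_zero, condEntropy_sub_condEntropy_classIndex hp hY,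
    Finset.sum_eq_zero_iff_of_nonneg fun ω _ => mul_log_law_fst_nonneg hp ω,
    ← law_fst_classIndex_eq_iff hp]
  constructor
  · intro h x y hy
    have hX := hy.trans_le (le_law hp Prod.fst (x, y))
    have hJ := hy.trans_le (le_law hp (fun ω => (ω.1, classIndex p ω.2)) (x, y))
    have h' := (mul_eq_zero.1 (h _ (Finset.mem_univ (x, y)))).resolve_left hy.ne'
    exact (eq_of_div_eq_one (Real.eq_one_of_pos_of_log_eq_zero (div_pos hX hJ) h')).symm
  · intro h ω _
    rcases (hp ω).eq_or_lt with h0 | h0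
    · simp [← h0]
    · rw [h ω.1 ω.2 h0, div_self (h0.trans_le (le_law hp Prod.fst ω)).ne', Real.log_one,
        mul_zero]

end Classes

/-! ### Connected components and saturability -/

section Graph

variable {𝒳 𝒴 : Type*} {p : 𝒳 × 𝒴 → ℝ}

theorem charGraph_adj_inl_inr {x : 𝒳} {y : 𝒴} (h : 0 < p (x, y)) :
    (charGraph p).Adj (Sum.inl x) (Sum.inr y) := by
  rw [charGraph, SimpleGraph.fromRel_adj]
  exact ⟨Sum.inl_ne_inr, Or.inl ⟨x, y, rfl, rfl, h⟩⟩

theorem connectedComponentMk_inl_eq_inr {x : 𝒳} {y : 𝒴} (h : 0 < p (x, y)) :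
    (charGraph p).connectedComponentMk (Sum.inl x) =
      (charGraph p).connectedComponentMk (Sum.inr y) :=
  SimpleGraph.ConnectedComponent.sound (charGraph_adj_inl_inr h).reachable

variable [Fintype 𝒳] [Fintype 𝒴]

/-- The vertices of the component of `y`: the symbols equivalent to `y`, and the `x` that occur
together with one of them. -/
def componentVertices (p : 𝒳 × 𝒴 → ℝ) (y : 𝒴) : Set (𝒳 ⊕ 𝒴) :=
  {v | Sum.elim (fun x => 0 < p (x, y)) (fun y' => classIndex p y' = classIndex p y) v}

/-- From an x to a y, the class is kept because x determines it; from a y to an x, because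
equivalent symbols have the same neighbours. -/
theorem mem_componentVertices_of_adj (hY : ∀ y, 0 < law p Prod.snd y)
    (h : ClassDeterminedByFst p) {y : 𝒴} {v w : 𝒳 ⊕ 𝒴} (hvw : (charGraph p).Adj v w)
    (hv : v ∈ componentVertices p y) : w ∈ componentVertices p y := by
  rw [charGraph, SimpleGraph.fromRel_adj] at hvw
  rcases hvw.2 with ⟨x, z, rfl, rfl, hxz⟩ | ⟨x, z, rfl, rfl, hxz⟩
  · exact h x z y hxz hv
  · exact pos_of_classIndex_eq hY hv hxz

theorem connectedComponentMk_eq_iff (hp : ∀ ω, 0 ≤ p ω) (hY : ∀ y, 0 < law p Prod.snd y)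
    (h : ClassDeterminedByFst p) (y : 𝒴) (v : 𝒳 ⊕ 𝒴) :
    (charGraph p).connectedComponentMk v = (charGraph p).connectedComponentMk (Sum.inr y) ↔
      v ∈ componentVertices p y := by
  constructor
  · intro hv
    obtain ⟨walk⟩ := SimpleGraph.ConnectedComponent.exact hv.symm
    have hwalk : ∀ {a b : 𝒳 ⊕ 𝒴}, (charGraph p).Walk a b → a ∈ componentVertices p y →
        b ∈ componentVertices p y := by
      intro a b w
      induction w with
      | nil => exact id
      | cons hadj _ ih => exact fun ha => ih (mem_componentVertices_of_adj hY h hadj ha)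
    exact hwalk walk rfl
  · rcases v with x | y'
    · exact connectedComponentMk_inl_eq_inr
    · intro hy'
      -- Positive mass gives y' a neighbour x, which equivalence makes a neighbour of y as well.
      obtain ⟨⟨x, _⟩, rfl, hx⟩ := exists_pos_of_law_pos hp (hY y')
      rw [← connectedComponentMk_inl_eq_inr hx,
        connectedComponentMk_inl_eq_inr (pos_of_classIndex_eq hY hy' hx)]

theorem isErgodicComponent_iff (hp : ∀ ω, 0 ≤ p ω) (hY : ∀ y, 0 < law p Prod.snd y) :
    (∀ (A : Set 𝒳) (B : Set 𝒴), IsComponent p A B → IsErgodicComponent p A B) ↔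
      ClassDeterminedByFst p := by
  have hiff : ∀ y y', condSetoid p y y' ↔ classIndex p y = classIndex p y' := fun y y' =>
    funext_iff.trans classIndex_eq_iff.symm
  constructor
  · intro h x y y' hy hy'
    obtain ⟨c, -, hB⟩ := h _ _ ⟨(condSetoid p).mem_classes y, rfl⟩
    have hmem : ∀ z, condSetoid p z y ↔
        (charGraph p).connectedComponentMk (Sum.inr z) = c := fun z => Set.ext_iff.1 hB z
    refine ((hiff _ _).1 ((hmem y').2 ?_)).symm
    rw [← (hmem y).1 ((hiff _ _).2 rfl), ← connectedComponentMk_inl_eq_inr hy,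
      connectedComponentMk_inl_eq_inr hy']
  · rintro h _ _ ⟨⟨y, rfl⟩, rfl⟩
    refine ⟨(charGraph p).connectedComponentMk (Sum.inr y), Set.ext fun x => ?_,
      Set.ext fun z => ?_⟩
    · refine Iff.trans ?_ (connectedComponentMk_eq_iff hp hY h y (Sum.inl x)).symm
      exact ⟨fun ⟨z, hz, hxz⟩ => pos_of_classIndex_eq hY ((hiff _ _).1 hz) hxz,
        fun hx => ⟨y, (hiff _ _).2 rfl, hx⟩⟩
    · exact (hiff z y).trans (connectedComponentMk_eq_iff hp hY h y (Sum.inr z)).symm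

theorem law_snd_maxCommon (hp : ∀ ω, 0 ≤ p ω) (y : 𝒴) :
    law p (fun ω => (ω.2, maxCommon p ω)) (y, (charGraph p).connectedComponentMk (Sum.inr y)) =
      law p Prod.snd y := by
  refine law_congr fun ⟨x, z⟩ hω => ?_
  simp only [Prod.mk.injEq, and_iff_left_iff_imp]
  rintro rfl
  exact connectedComponentMk_inl_eq_inr (lt_of_le_of_ne (hp _) hω.symm)

theorem law_fst_snd_maxCommon (hp : ∀ ω, 0 ≤ p ω) (x : 𝒳) (y : 𝒴) :
    law p (fun ω => (ω.1, ω.2, maxCommon p ω))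
      (x, y, (charGraph p).connectedComponentMk (Sum.inr y)) = p (x, y) := by
  rw [← law_of_injective (μ := p) Function.injective_id (x, y)]
  refine law_congr fun ⟨x', y'⟩ hω => ?_
  simp only [Prod.mk.injEq, id]
  constructor
  · exact fun h => ⟨h.1, h.2.1⟩
  · rintro ⟨rfl, rfl⟩
    exact ⟨rfl, rfl, connectedComponentMk_inl_eq_inr (lt_of_le_of_ne (hp _) hω.symm)⟩

/-- Independence given the connected component makes p(x'|z) the same for all z in that component,
in particular for two neighbours of one x. Conversely, when X determines K, conditioning on the
component of y amounts to conditioning on its class, and the claim becomes X - K - Y. -/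
theorem saturable_iff (hp : ∀ ω, 0 ≤ p ω) (hY : ∀ y, 0 < law p Prod.snd y) :
    Saturable p ↔ ClassDeterminedByFst p := by
  classical
  refine (condMutualInfo_eq_zero_iff hp _ _ _).trans ⟨fun h => ?_, fun h => ?_⟩
  · intro x y y' hy hy'
    rw [classIndex_eq_iff]
    set c := maxCommon p (x, y) with hc
    suffices H : ∀ x' z, 0 < p (x, z) →
        condProb p x' z = law p (fun ω => (ω.1, maxCommon p ω)) (x', c) / law p (maxCommon p) c by
      intro x'
      rw [H x' y hy, H x' y' hy']
    intro x' z hz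
    have hcz : c = (charGraph p).connectedComponentMk (Sum.inr z) :=
      connectedComponentMk_inl_eq_inr hz
    have hpc : 0 < law p (maxCommon p) c := hy.trans_le (le_law hp (maxCommon p) (x, y))
    have e := h x' z c
    rw [hcz, law_snd_maxCommon hp, law_fst_snd_maxCommon hp, ← hcz] at e
    rw [condProb, div_eq_div_iff (hY z).ne' hpc.ne']
    linear_combination e
  · intro x y c
    by_cases hc : c = (charGraph p).connectedComponentMk (Sum.inr y)
    · subst hc
      -- Off null points, lying in the component of y and having Y equivalent to y are the same
      -- event.
      have hmem : ∀ ω : 𝒳 × 𝒴, p ω ≠ 0 →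
          (maxCommon p ω = (charGraph p).connectedComponentMk (Sum.inr y) ↔
            classIndex p ω.2 = classIndex p y) := fun ω hω => by
        rw [maxCommon, connectedComponentMk_inl_eq_inr (lt_of_le_of_ne (hp ω) hω.symm)]
        exact connectedComponentMk_eq_iff hp hY h y (Sum.inr ω.2)
      rw [law_snd_maxCommon hp, law_fst_snd_maxCommon hp, law_congr hmem, law_class_mul hY]
      congr 1
      refine law_congr fun ω hω => ?_
      simp only [Prod.mk.injEq, hmem ω hω]
    · have hne : ∀ ω : 𝒳 × 𝒴, p ω ≠ 0 → ω.2 = y → maxCommon p ω ≠ c := fun ω hω h2 h3 =>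
        hc (by rw [← h3, ← h2, maxCommon,
          connectedComponentMk_inl_eq_inr (lt_of_le_of_ne (hp ω) hω.symm)])
      rw [law_eq_zero (U := fun ω : 𝒳 × 𝒴 => (ω.1, ω.2, maxCommon p ω)), mul_zero,
        law_eq_zero (U := fun ω : 𝒳 × 𝒴 => (ω.2, maxCommon p ω)), mul_zero]
      · intro ω hω heq
        simp only [Prod.mk.injEq] at heq
        exact hne ω hω heq.1 heq.2
      · intro ω hω heq
        simp only [Prod.mk.injEq] at heq
        exact hne ω hω heq.2.1 heq.2.2

end Graph

end PrivateInfo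

end

theorem theorem2 {𝒳 𝒴 : Type*} [Fintype 𝒳] [Fintype 𝒴] (p : 𝒳 × 𝒴 → ℝ)
    (hp : p ∈ stdSimplex ℝ (𝒳 × 𝒴))
    (hY : ∀ y, 0 < PrivateInfo.law p Prod.snd y) :
    IsGreatest (PrivateInfo.privateInfoValues p) (PrivateInfo.privateInfo p) ∧
    0 ≤ PrivateInfo.privateInfo p ∧
    PrivateInfo.privateInfo p ≤ PrivateInfo.condEntropy p Prod.snd Prod.fst ∧
    (PrivateInfo.privateInfo p = 0 ↔
      ¬ ∃ (A : Set 𝒳) (B : Set 𝒴), PrivateInfo.IsComponent p A B ∧ 1 < B.ncard) ∧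
    (PrivateInfo.privateInfo p = PrivateInfo.condEntropy p Prod.snd Prod.fst ↔
      PrivateInfo.Saturable p) ∧
    (PrivateInfo.Saturable p ↔
      ∀ (A : Set 𝒳) (B : Set 𝒴), PrivateInfo.IsComponent p A B →
        PrivateInfo.IsErgodicComponent p A B) := by
  have hM := PrivateInfo.privateInfo_eq hp hY
  refine ⟨?_, ?_, ?_, ?_, ?_, ?_⟩
  · rw [hM]
    exact PrivateInfo.isGreatest_condEntropy_classIndex hp hY
  · rw [hM]
    exact PrivateInfo.condEntropy_classIndex_nonneg hp.1 hY
  · rw [hM]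
    exact PrivateInfo.condEntropy_classIndex_le hp.1 hY
  · rw [hM, PrivateInfo.condEntropy_classIndex_eq_zero_iff hp.1 hY,
      PrivateInfo.component_size_le_one_iff]
  · rw [hM, PrivateInfo.condEntropy_classIndex_eq_iff hp.1 hY,
      PrivateInfo.saturable_iff hp.1 hY]
  · rw [PrivateInfo.saturable_iff hp.1 hY, PrivateInfo.isErgodicComponent_iff hp.1 hY]
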